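/- Let $d\ge 1$ and let $\lambda$ be a nonzero Lévy measure on $\mathbb{R}$ with $\int_{\mathbb{R}}|z|\,\lambda(\mathrm{d}z)<\infty$. Let $\mu$ be a Poisson random measure on $(0,\infty)\times\mathbb{R}^d\times\mathbb{R}$ with intensity measure $\mathrm{d}t\,\mathrm{d}x\,\lambda(\mathrm{d}z)$, let $m\in\mathbb{R}$, put $m_0=m-\int_{\mathbb{R}}z\,\lambda(\mathrm{d}z)$, and let $$\Lambda(\mathrm{d}t,\mathrm{d}x)=m_0\,\mathrm{d}t\,\mathrm{d}x+\int_{\mathbb{R}}z\,\mu(\mathrm{d}t,\mathrm{d}x,\mathrm{d}z)$$ be the corresponding Lévy space-time white noise with mean $m$. Let $$Y(t,x)=\int_0^t\int_{\mathbb{R}^d}g(t-s,x-y)\,\Lambda(\mathrm{d}s,\mathrm{d}y),\qquad g(t,x)=\frac{1}{(4\pi t)^{d/2}}e^{-|x|^2/(4t)}\mathbf{1}_{t>0},$$ be the mild solution of the stochastic heat equation $\partial_tY=\Delta Y+\dot\Lambda$ on $(0,\infty)\times\mathbb{R}^d$ with $Y(0,\cdot)=0$, and write $Y_0(t)=Y(t,0)$.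 Suppose that for some $\varepsilon>0$ $$\int_{\mathbb{R}}|z|^{1+\varepsilon}\,\lambda(\mathrm{d}z)<\infty\qquad\text{and}\qquad\int_{[-1,1]}\bigl|z\log|z|\bigr|\,\lambda(\mathrm{d}z)<\infty .$$ Then for every $p\in(0,1+\varepsilon]\cap(0,1+2/d)$ the following holds: for every $t>0$ the integral defining $Y_0(t)$ converges absolutely almost surely and $Y_0(t)/t\in L^p$; and $$\frac{Y_0(t)}{t}\longrightarrow m\quad\text{in }L^p\text{ as }t\to\infty,\qquad\text{that is,}\qquad \lim_{t\to\infty}\mathbb{E}\left[\left|\frac{Y_0(t)}{t}-m\right|^p\right]=0 .$$ -/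

import Mathlib

open MeasureTheory ProbabilityTheory Filter Topology
open scoped ENNReal NNReal

noncomputable section

namespace LevyHeat

/-- The spatial domain `ℝ^d` with its Euclidean norm. -/
abbrev Space (d : ℕ) : Type := EuclideanSpace ℝ (Fin d)

/-- The Poisson distribution with mean `a ∈ [0, ∞]`, as a law on `[0, ∞]`; for `a = ∞` it is the
point mass at `∞`. -/
def poissonLaw (a : ℝ≥0∞) : Measure ℝ≥0∞ :=
  if a = ∞ then Measure.dirac ∞
  else (poissonMeasure a.toNNReal).map (fun n : ℕ => (n : ℝ≥0∞))

/-- `μ` is a Poisson random measure on `E` with intensity measure `ν`, on the probability space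
`(Ω, P)`. -/
structure IsPoissonRandomMeasure {Ω E : Type*} [MeasurableSpace Ω] [MeasurableSpace E]
    (μ : Ω → Measure E) (ν : Measure E) (P : Measure Ω) : Prop where
  measurable : ∀ A : Set E, MeasurableSet A → Measurable (fun ω => μ ω A)
  law : ∀ A : Set E, MeasurableSet A → P.map (fun ω => μ ω A) = poissonLaw (ν A)
  indep : ∀ (n : ℕ) (A : Fin n → Set E), (∀ i, MeasurableSet (A i)) →
    Pairwise (fun i j => Disjoint (A i) (A j)) → iIndepFun (fun i ω => μ ω (A i)) P

/-- A Lévy measure on `ℝ`. -/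
structure IsLevyMeasure (lam : Measure ℝ) : Prop where
  zero : lam {0} = 0
  integrable : Integrable (fun z : ℝ => min 1 (z ^ 2)) lam

/-- The intensity measure `dt dx λ(dz)` on `(0, ∞) × ℝ^d × ℝ`, seen as a measure on
`ℝ × ℝ^d × ℝ` that is carried by positive times. -/
def intensity (d : ℕ) (lam : Measure ℝ) : Measure (ℝ × Space d × ℝ) :=
  ((volume : Measure ℝ).restrict (Set.Ioi 0)).prod ((volume : Measure (Space d)).prod lam)

/-- The drift `m₀ = m - ∫ z λ(dz)` of the noise with mean `m`. -/
def drift (m : ℝ) (lam : Measure ℝ) : ℝ := m - ∫ z, z ∂lam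

/-- The integral `∫ h dΛ` of a deterministic function `h(s, y)` with respect to
`Λ(ds, dy) = m₀ ds dy + ∫_ℝ z μ(ds, dy, dz)`, on the outcome whose jump measure is `μω`. -/
def noiseIntegral {d : ℕ} (m : ℝ) (lam : Measure ℝ) (μω : Measure (ℝ × Space d × ℝ))
    (h : ℝ → Space d → ℝ) : ℝ :=
  drift m lam * (∫ q : ℝ × Space d, h q.1 q.2 ∂(((volume : Measure ℝ).restrict (Set.Ioi 0)).prod volume))
    + ∫ q : ℝ × Space d × ℝ, h q.1 q.2.1 * q.2.2 ∂μω

/-- Both integrals in `noiseIntegral` converge absolutely. -/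
def NoiseIntegrable {d : ℕ} (μω : Measure (ℝ × Space d × ℝ)) (h : ℝ → Space d → ℝ) : Prop :=
  Integrable (fun q : ℝ × Space d => h q.1 q.2)
      (((volume : Measure ℝ).restrict (Set.Ioi 0)).prod volume) ∧
    Integrable (fun q : ℝ × Space d × ℝ => h q.1 q.2.1 * q.2.2) μω

/-- The heat kernel `g(t, x)` of `∂_t - Δ` on `ℝ^d`, extended by `0` to `t ≤ 0`. -/
def heatKernel (d : ℕ) (t : ℝ) (x : Space d) : ℝ :=
  if 0 < t then
    1 / (4 * Real.pi * t) ^ ((d : ℝ) / 2) * Real.exp (-(‖x‖ ^ 2) / (4 * t))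
  else 0

/-- The integrand `1_{(0, t]}(s) g(t - s, x - y)` of the mild solution at `(t, x)`. -/
def mildKernel {d : ℕ} (t : ℝ) (x : Space d) : ℝ → Space d → ℝ := fun s y =>
  (Set.Ioc 0 t).indicator (fun s => heatKernel d (t - s) (x - y)) s

/-- The mild solution `Y(t, x) = ∫_0^t ∫ g(t - s, x - y) Λ(ds, dy)` of
`∂_t Y = Δ Y + Λ̇`, `Y(0, ·) = 0`, as a random variable. -/
def mildSolution {Ω : Type*} {d : ℕ} (m : ℝ) (lam : Measure ℝ)
    (μ : Ω → Measure (ℝ × Space d × ℝ)) (t : ℝ) (x : Space d) (ω : Ω) : ℝ :=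
  noiseIntegral m lam (μ ω) (mildKernel t x)

end LevyHeat

end

/-! The heat kernel has mass one at every positive time, so `Y_0(t)/t - m` is the integral of
`f_t(s, y, z) = g(t - s, y) z / t` (for `0 < s ≤ t`) against `μ - ν`, where `ν` is the intensity. If
`q > 1` and `d (q - 1) / 2 < 1`, Gaussian scaling gives `∫ |f_t|^q dν = c t^(-(d/2 + 1)(q - 1)) ∫
|z|^q dλ`, which tends to `0`. It remains to bound moments of centred Poisson integrals by such
quantities; exponents `p ≤ 1` follow from some `q > 1` by monotonicity of `L^p` norms.

For a simple function the centred integral is `S = ∑ a_i (N_i - r_i)` with independent Poisson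
`N_i`. Put `φ(x) = sign x |x|^(p-1)`, so that `|S|^p = S φ(S)`. The identity `E[N h(N)] = r E[h(N +
1)]` turns this into `E|S|^p = ∑ r_i E[a_i (φ(S + a_i) - φ(S))]` (`integral_abs_rpow_poissonSum`).
For `p ≤ 2` the Hölder bound on `φ` gives `E|S|^p ≤ 2 ∑ |a_i|^p r_i`. For `2 ≤ p ≤ 3` the increment
costs at most `2 a_i^2 (1 + S^2) + |a_i|^p`, and `E S^2` is controlled by the case `p = 2`.
Exponents up to `3` suffice because `1 + 2/d ≤ 3`. Dominated convergence and Fatou pass from simple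
to integrable functions. -/

namespace LevyHeat

/-! ### Increments of odd powers -/

/-- The odd power function `x ↦ sign x * |x| ^ (p - 1)`. -/
noncomputable def oddPow (p x : ℝ) : ℝ := x * |x| ^ (p - 2)

lemma mul_oddPow {p : ℝ} (hp : 1 < p) (x : ℝ) : x * oddPow p x = |x| ^ p := by
  unfold oddPow
  rcases eq_or_ne x 0 with rfl | hx
  · simp [Real.zero_rpow (by linarith : p ≠ 0)]
  · have : p = 2 + (p - 2) := by ring
    conv_rhs => rw [this, Real.rpow_add (abs_pos.2 hx)]
    rw [← mul_assoc, Real.rpow_two, sq_abs, sq]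

lemma abs_oddPow {p : ℝ} (hp : 1 < p) (x : ℝ) : |oddPow p x| = |x| ^ (p - 1) := by
  unfold oddPow
  rcases eq_or_ne x 0 with rfl | hx
  · simp [Real.zero_rpow (by linarith : p - 1 ≠ 0)]
  · have : p - 1 = 1 + (p - 2) := by ring
    rw [this, Real.rpow_add (abs_pos.2 hx), Real.rpow_one, abs_mul, abs_of_nonneg (a := _ ^ _)]
    positivity

lemma oddPow_of_nonneg {p : ℝ} (hp : 1 < p) {x : ℝ} (hx : 0 ≤ x) : oddPow p x = x ^ (p - 1) := by
  have h := abs_oddPow hp x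
  rwa [abs_of_nonneg hx, abs_of_nonneg] at h
  unfold oddPow; positivity

lemma oddPow_neg (p x : ℝ) : oddPow p (-x) = -oddPow p x := by
  simp [oddPow]

lemma measurable_oddPow (p : ℝ) : Measurable (oddPow p) := by
  unfold oddPow; fun_prop

lemma oddPow_mono {p : ℝ} (hp : 1 < p) : Monotone (oddPow p) := by
  have key : ∀ x y : ℝ, 0 ≤ x → x ≤ y → oddPow p x ≤ oddPow p y := fun x y hx hxy => by
    rw [oddPow_of_nonneg hp hx, oddPow_of_nonneg hp (hx.trans hxy)]
    exact Real.rpow_le_rpow hx hxy (by linarith)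
  have hnn : ∀ x : ℝ, 0 ≤ x → 0 ≤ oddPow p x := fun x hx => by unfold oddPow; positivity
  intro x y hxy
  rcases le_total 0 x with hx | hx
  · exact key x y hx hxy
  · rcases le_total 0 y with hy | hy
    · have := hnn (-x) (by linarith)
      rw [oddPow_neg] at this
      linarith [hnn y hy]
    · have := key (-y) (-x) (by linarith) (by linarith)
      rw [oddPow_neg, oddPow_neg] at this
      linarith

/-- For arguments of one sign this is subadditivity of `u ↦ u^(p-1)`. If `x ≤ 0 ≤ y`, both `|x|` and
`|y|` are at most `y - x`, and the two contributions produce the factor `2`. -/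
lemma oddPow_sub_le_of_le {p : ℝ} (hp : 1 < p) (hp2 : p ≤ 2) {x y : ℝ} (hxy : x ≤ y) :
    oddPow p y - oddPow p x ≤ 2 * (y - x) ^ (p - 1) := by
  have key : ∀ x y : ℝ, 0 ≤ x → x ≤ y → oddPow p y - oddPow p x ≤ 2 * (y - x) ^ (p - 1) := by
    intro x y hx hxy
    rw [oddPow_of_nonneg hp hx, oddPow_of_nonneg hp (hx.trans hxy)]
    have h := Real.rpow_add_le_add_rpow hx (sub_nonneg.2 hxy) (by linarith : 0 ≤ p - 1)
      (by linarith)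
    rw [add_sub_cancel] at h
    have : 0 ≤ (y - x) ^ (p - 1) := Real.rpow_nonneg (by linarith) _
    linarith
  rcases le_total 0 x with hx | hx
  · exact key x y hx hxy
  · rcases le_total 0 y with hy | hy
    · have h1 : oddPow p y ≤ (y - x) ^ (p - 1) := by
        rw [oddPow_of_nonneg hp hy]
        exact Real.rpow_le_rpow hy (by linarith) (by linarith)
      have h2 : oddPow p (-x) ≤ (y - x) ^ (p - 1) := by
        rw [oddPow_of_nonneg hp (by linarith)]
        exact Real.rpow_le_rpow (by linarith) (by linarith) (by linarith)
      rw [oddPow_neg] at h2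
      linarith
    · have := key (-y) (-x) (by linarith) (by linarith)
      rw [oddPow_neg, oddPow_neg, show -x - -y = y - x by ring] at this
      linarith

lemma mul_oddPow_add_sub_le {p : ℝ} (hp : 1 < p) (hp2 : p ≤ 2) (x a : ℝ) :
    a * (oddPow p (x + a) - oddPow p x) ≤ 2 * |a| ^ p := by
  have hpow : |a| ^ p = |a| * |a| ^ (p - 1) := by
    rw [← Real.rpow_one_add' (abs_nonneg a) (by linarith)]; congr 1; ring
  rw [hpow]
  rcases le_total 0 a with ha | ha
  · have := oddPow_sub_le_of_le hp hp2 (show x ≤ x + a by linarith)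
    rw [add_sub_cancel_left] at this
    rw [abs_of_nonneg ha]
    nlinarith
  · have := oddPow_sub_le_of_le hp hp2 (show x + a ≤ x by linarith)
    rw [show x - (x + a) = -a by ring] at this
    rw [abs_of_nonpos ha]
    nlinarith

/-- A substitute for the mean value theorem that needs no smoothness at `0`: after scaling by `y` it
reads `|u^r - 1| ≤ |u - 1|` for `u ≥ 0` and `r ∈ [0, 1]`. -/
lemma mul_abs_rpow_sub_rpow_le {r s y : ℝ} (hr : 0 ≤ r) (hr1 : r ≤ 1) (hs : 0 ≤ s) (hy : 0 ≤ y) :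
    y * |s ^ r - y ^ r| ≤ |s - y| * y ^ r := by
  rcases hy.eq_or_lt with rfl | hy
  · simp only [zero_mul]; positivity
  have hsy : 0 ≤ s / y := by positivity
  have hs' : s ^ r = (s / y) ^ r * y ^ r := by
    rw [← Real.mul_rpow hsy hy.le, div_mul_cancel₀ _ hy.ne']
  have hd : s - y = y * (s / y - 1) := by field_simp
  have : |(s / y) ^ r - 1| ≤ |s / y - 1| := by
    rcases le_total 1 (s / y) with h | h
    · rw [abs_of_nonneg (sub_nonneg.2 h), abs_of_nonneg (sub_nonneg.2 (Real.one_le_rpow h hr))]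
      have := Real.rpow_le_rpow_of_exponent_le h hr1
      rw [Real.rpow_one] at this
      linarith
    · rw [abs_of_nonpos (sub_nonpos.2 h), abs_of_nonpos (sub_nonpos.2 (Real.rpow_le_one hsy h hr))]
      have : s / y ≤ (s / y) ^ r := by
        rcases hsy.eq_or_lt with h0 | h0
        · rw [← h0]; exact Real.zero_rpow_nonneg r
        · simpa using Real.rpow_le_rpow_of_exponent_ge h0 h hr1
      linarith
  rw [hs', hd, abs_mul, abs_of_pos hy, ← sub_one_mul, abs_mul, abs_of_nonneg (a := y ^ r)
    (by positivity)]
  have h0 : 0 ≤ y ^ r := by positivity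
  calc y * (|(s / y) ^ r - 1| * y ^ r) ≤ y * (|s / y - 1| * y ^ r) := by gcongr
    _ = _ := by ring

/-- The left side splits as `a^2 |x+a|^(p-2) + a x (|x+a|^(p-2) - |x|^(p-2))`, and `p - 2 ≤ 1` makes
the power subadditive. Trading `|x|^(p-2)` for `1 + x^2` leaves an expression whose expectation
involves only the second moment. -/
lemma mul_oddPow_add_sub_le_of_two_le {p : ℝ} (hp : 2 ≤ p) (hp3 : p ≤ 3) (x a : ℝ) :
    a * (oddPow p (x + a) - oddPow p x) ≤ 2 * a ^ 2 * (1 + x ^ 2) + |a| ^ p := by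
  have hr : 0 ≤ p - 2 := by linarith
  have hr1 : p - 2 ≤ 1 := by linarith
  have hpow : |a| ^ p = a ^ 2 * |a| ^ (p - 2) := by
    rw [← sq_abs, ← Real.rpow_two, ← Real.rpow_add' (abs_nonneg a) (by linarith)]; congr 1; ring
  have hx : |x| ^ (p - 2) ≤ 1 + x ^ 2 := by
    rcases le_total |x| 1 with h | h
    · have := Real.rpow_le_one (abs_nonneg x) h hr
      nlinarith [sq_nonneg x]
    · have := Real.rpow_le_rpow_of_exponent_le h (by linarith : p - 2 ≤ 2)
      rw [Real.rpow_two, sq_abs] at this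
      linarith
  have hxa : |x + a| ^ (p - 2) ≤ |x| ^ (p - 2) + |a| ^ (p - 2) :=
    (Real.rpow_le_rpow (abs_nonneg _) (abs_add_le x a) hr).trans
      (Real.rpow_add_le_add_rpow (abs_nonneg x) (abs_nonneg a) hr hr1)
  have h3 := mul_abs_rpow_sub_rpow_le hr hr1 (abs_nonneg (x + a)) (abs_nonneg x)
  have h4 : |(|x + a| - |x|)| ≤ |a| := by simpa using abs_abs_sub_abs_le_abs_sub (x + a) x
  have h5 : a * (x * (|x + a| ^ (p - 2) - |x| ^ (p - 2))) ≤ a ^ 2 * |x| ^ (p - 2) := by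
    refine (le_abs_self _).trans ?_
    rw [abs_mul, abs_mul, ← sq_abs a, sq, mul_assoc]
    refine mul_le_mul_of_nonneg_left (h3.trans ?_) (abs_nonneg a)
    exact mul_le_mul_of_nonneg_right h4 (Real.rpow_nonneg (abs_nonneg x) _)
  have h6 : a * (oddPow p (x + a) - oddPow p x)
      = a ^ 2 * |x + a| ^ (p - 2) + a * (x * (|x + a| ^ (p - 2) - |x| ^ (p - 2))) := by
    unfold oddPow; ring
  rw [h6, hpow]
  nlinarith [mul_le_mul_of_nonneg_left hxa (sq_nonneg a), mul_le_mul_of_nonneg_left hx (sq_nonneg a)]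

/-! ### The Poisson distribution -/

lemma lintegral_natCast_mul_poissonMeasure (r : ℝ≥0) (h : ℕ → ℝ≥0∞) :
    ∫⁻ n, (n : ℝ≥0∞) * h n ∂poissonMeasure r = r * ∫⁻ n, h (n + 1) ∂poissonMeasure r := by
  rw [lintegral_countable', lintegral_countable', tsum_eq_zero_add' ENNReal.summable,
    ← ENNReal.tsum_mul_left]
  simp only [Nat.cast_zero, zero_mul, zero_add]
  congr 1 with n
  have : ((n + 1 : ℕ) : ℝ≥0∞) * poissonMeasure r {n + 1} = r * poissonMeasure r {n} := by
    rw [poissonMeasure_singleton, poissonMeasure_singleton, ← ENNReal.ofReal_natCast,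
      ← ENNReal.ofReal_coe_nnreal, ← ENNReal.ofReal_mul (by positivity),
      ← ENNReal.ofReal_mul (by positivity)]
    congr 1
    rw [Nat.factorial_succ]
    push_cast
    field_simp
    ring
  calc _ = h (n + 1) * (((n + 1 : ℕ) : ℝ≥0∞) * poissonMeasure r {n + 1}) := by ring
    _ = _ := by rw [this]; ring

/-- As an equality of measures, the size-bias identity tensorises with the law of an independent
variable and yields Bochner integrals without integrability assumptions. -/
lemma poissonMeasure_withDensity (r : ℝ≥0) :
    (poissonMeasure r).withDensity (fun n : ℕ => ((n : ℝ≥0) : ℝ≥0∞))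
      = r • (poissonMeasure r).map (· + 1) := by
  refine Measure.ext_of_lintegral _ fun h hh => ?_
  rw [lintegral_withDensity_eq_lintegral_mul _ (by fun_prop) hh, lintegral_smul_measure,
    lintegral_map hh (by fun_prop)]
  simpa [ENNReal.smul_def] using lintegral_natCast_mul_poissonMeasure r h

lemma lintegral_pow_poissonMeasure_lt_top (r : ℝ≥0) (k : ℕ) :
    ∫⁻ n, (n : ℝ≥0∞) ^ k ∂poissonMeasure r < ∞ := by
  induction k with
  | zero => simp
  | succ k ih =>
    simp_rw [pow_succ']
    rw [lintegral_natCast_mul_poissonMeasure r fun n => (n : ℝ≥0∞) ^ k]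
    refine ENNReal.mul_lt_top (by simp) ?_
    -- `n + 1 ≤ 2 n` fails only at `n = 0`, which the extra `1` covers.
    calc ∫⁻ n, ((n + 1 : ℕ) : ℝ≥0∞) ^ k ∂poissonMeasure r
        ≤ ∫⁻ n, 2 ^ k * (n : ℝ≥0∞) ^ k + 1 ∂poissonMeasure r := by
          refine lintegral_mono fun n => ?_
          rcases Nat.eq_zero_or_pos n with rfl | hn
          · simp
          · refine le_trans ?_ le_self_add
            rw [← mul_pow]
            gcongr
            exact_mod_cast (by omega : n + 1 ≤ 2 * n)
      _ < ∞ := by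
          rw [lintegral_add_right _ measurable_const, lintegral_const_mul _ (by fun_prop)]
          simp only [lintegral_const, measure_univ, mul_one]
          exact ENNReal.add_lt_top.2 ⟨ENNReal.mul_lt_top (by simp) ih, by simp⟩

variable {Ω : Type*} [MeasurableSpace Ω] {P : Measure Ω} [IsProbabilityMeasure P]

/-- The Chen–Stein identity for a Poisson variable and an independent real variable. -/
lemma integral_natCast_mul_of_indepFun_poisson {r : ℝ≥0} {T : Ω → ℝ} {N : Ω → ℕ}
    (hT : Measurable T) (hN : Measurable N) (hlaw : P.map N = poissonMeasure r)
    (hind : IndepFun T N P) {k : ℝ × ℕ → ℝ} (hk : Measurable k) :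
    ∫ ω, (N ω : ℝ) * k (T ω, N ω) ∂P = r * ∫ ω, k (T ω, N ω + 1) ∂P := by
  have hprod := (indepFun_iff_map_prod_eq_prod_map_map hT.aemeasurable hN.aemeasurable).1 hind
  rw [hlaw] at hprod
  have : IsProbabilityMeasure (P.map T) := Measure.isProbabilityMeasure_map hT.aemeasurable
  have h1 : ∫ ω, (N ω : ℝ) * k (T ω, N ω) ∂P
      = ∫ x, (x.2 : ℝ) * k x ∂((P.map T).prod (poissonMeasure r)) := by
    rw [← hprod, integral_map (by fun_prop)]
    exact Measurable.aestronglyMeasurable (by fun_prop)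
  have h2 : ∫ ω, k (T ω, N ω + 1) ∂P
      = ∫ x, k (x.1, x.2 + 1) ∂((P.map T).prod (poissonMeasure r)) := by
    rw [← hprod, integral_map (by fun_prop)]
    exact Measurable.aestronglyMeasurable (by fun_prop)
  have h3 := integral_withDensity_eq_integral_smul (μ := (P.map T).prod (poissonMeasure r))
    (f := fun x => (x.2 : ℝ≥0)) (by fun_prop) k
  rw [← prod_withDensity_right (g := fun n : ℕ => ((n : ℝ≥0) : ℝ≥0∞)) (by fun_prop),
    poissonMeasure_withDensity] at h3
  simp only [NNReal.smul_def, NNReal.coe_natCast, smul_eq_mul] at h3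
  rw [h1, h2, ← h3]
  have h4 : (P.map T).prod (r • (poissonMeasure r).map (· + 1))
      = r • ((P.map T).prod (poissonMeasure r)).map (Prod.map id (· + 1)) := by
    rw [← Measure.map_prod_map _ _ measurable_id (by fun_prop), Measure.map_id]
    exact Measure.prod_smul_right (r : ℝ≥0∞)
  rw [h4, integral_smul_nnreal_measure, integral_map (by fun_prop) hk.aestronglyMeasurable]
  rfl

end LevyHeat

/-! ### Moments of finite sums of independent centred Poisson variables -/

namespace LevyHeat

variable {Ω : Type*} [MeasurableSpace Ω] {P : Measure Ω}

lemma memLp_natCast_of_poisson {r : ℝ≥0} {N : Ω → ℕ} (hN : Measurable N)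
    (hlaw : P.map N = poissonMeasure r) (k : ℕ) : MemLp (fun ω => (N ω : ℝ)) k P := by
  rcases Nat.eq_zero_or_pos k with rfl | hk
  · simpa using Measurable.aestronglyMeasurable (by fun_prop)
  refine ⟨Measurable.aestronglyMeasurable (by fun_prop), ?_⟩
  rw [eLpNorm_lt_top_iff_lintegral_rpow_enorm_lt_top (by simpa using hk.ne') (by simp)]
  have h := lintegral_pow_poissonMeasure_lt_top r k
  rw [← hlaw, lintegral_map (by fun_prop) hN] at h
  convert h using 3 with ω
  rw [Real.enorm_natCast]
  simp

section FiniteSum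

variable [IsProbabilityMeasure P] {ι : Type*} [Fintype ι] {N : ι → Ω → ℕ} {r : ι → ℝ≥0}

lemma memLp_poissonSum (hN : ∀ i, Measurable (N i)) (hlaw : ∀ i, P.map (N i) = poissonMeasure (r i))
    (a : ι → ℝ) (k : ℕ) : MemLp (fun ω => ∑ i, a i * ((N i ω : ℝ) - r i)) k P :=
  memLp_finsetSum _ fun i _ =>
    ((memLp_natCast_of_poisson (hN i) (hlaw i) k).sub (memLp_const _)).const_mul (a i)

lemma integrable_mul_oddPow {p : ℝ} (hp : 1 < p) (hp3 : p ≤ 3) {X Y : Ω → ℝ}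
    (hX : MemLp X 3 P) (hY : MemLp Y 3 P) : Integrable (fun ω => X ω * oddPow p (Y ω)) P := by
  have hint : Integrable (fun ω => ‖1 + |X ω| + |Y ω|‖ ^ 3) P :=
    (((memLp_const (1 : ℝ)).add hX.abs).add hY.abs).integrable_norm_pow (by norm_num)
  refine hint.mono' (hX.1.mul ((measurable_oddPow p).comp_aemeasurable
    hY.1.aemeasurable).aestronglyMeasurable) (ae_of_all _ fun ω => ?_)
  have h1 : |Y ω| ^ (p - 1) ≤ (1 + |X ω| + |Y ω|) ^ 2 := by
    have h0 : 1 ≤ 1 + |X ω| + |Y ω| := by linarith [abs_nonneg (X ω), abs_nonneg (Y ω)]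
    calc |Y ω| ^ (p - 1) ≤ (1 + |X ω| + |Y ω|) ^ (p - 1) :=
          Real.rpow_le_rpow (abs_nonneg _) (by linarith [abs_nonneg (X ω)]) (by linarith)
      _ ≤ (1 + |X ω| + |Y ω|) ^ (2 : ℝ) := Real.rpow_le_rpow_of_exponent_le h0 (by linarith)
      _ = _ := Real.rpow_two _
  have h2 : |X ω| ≤ 1 + |X ω| + |Y ω| := by linarith [abs_nonneg (Y ω)]
  rw [Real.norm_eq_abs, Real.norm_eq_abs, abs_mul, abs_oddPow hp,
    abs_of_nonneg (a := 1 + |X ω| + |Y ω|) (by positivity)]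
  calc |X ω| * |Y ω| ^ (p - 1) ≤ (1 + |X ω| + |Y ω|) * (1 + |X ω| + |Y ω|) ^ 2 := by gcongr
    _ = _ := by ring

variable [DecidableEq ι]

/-- The part of the sum with `j ≠ i` is independent of `N i`, so the Chen–Stein identity applies;
raising `N i` by one shifts the whole sum by `a i`. -/
lemma integral_natCast_mul_oddPow_poissonSum (hN : ∀ i, Measurable (N i))
    (hlaw : ∀ i, P.map (N i) = poissonMeasure (r i)) (hind : iIndepFun N P) (a : ι → ℝ) (p : ℝ)
    (i : ι) :
    ∫ ω, (N i ω : ℝ) * oddPow p (∑ j, a j * ((N j ω : ℝ) - r j)) ∂P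
      = r i * ∫ ω, oddPow p (∑ j, a j * ((N j ω : ℝ) - r j) + a i) ∂P := by
  have hT : Measurable fun ω => ∑ j ∈ Finset.univ.erase i, a j * ((N j ω : ℝ) - r j) := by
    fun_prop
  have hTN : IndepFun (fun ω => ∑ j ∈ Finset.univ.erase i, a j * ((N j ω : ℝ) - r j)) (N i) P := by
    have hψ : Measurable fun x : ({i} : Finset ι) → ℕ => x ⟨i, by simp⟩ := by fun_prop
    have h := hind.indepFun_finset (Finset.univ.erase i) {i} (by simp) hN
    have h' := h.comp (φ := fun x : Finset.univ.erase i → ℕ =>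
        ∑ j : Finset.univ.erase i, a j * ((x j : ℝ) - r j))
      (by fun_prop) hψ
    refine h'.congr (ae_of_all _ fun ω => ?_) (ae_of_all _ fun ω => rfl)
    exact (Finset.sum_coe_sort (Finset.univ.erase i) fun j => a j * ((N j ω : ℝ) - r j))
  have hk : Measurable fun x : ℝ × ℕ => oddPow p (x.1 + a i * ((x.2 : ℝ) - r i)) :=
    (measurable_oddPow p).comp (by fun_prop)
  have key := integral_natCast_mul_of_indepFun_poisson hT (hN i) (hlaw i) hTN hk
  have hsum : ∀ ω, ∑ j, a j * ((N j ω : ℝ) - r j)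
      = ∑ j ∈ Finset.univ.erase i, a j * ((N j ω : ℝ) - r j) + a i * ((N i ω : ℝ) - r i) :=
    fun ω => (Finset.sum_erase_add _ _ (Finset.mem_univ i)).symm
  simp_rw [hsum]
  rw [key]
  congr! 4 with ω
  push_cast
  ring

lemma integral_abs_rpow_poissonSum (hN : ∀ i, Measurable (N i))
    (hlaw : ∀ i, P.map (N i) = poissonMeasure (r i)) (hind : iIndepFun N P) (a : ι → ℝ) {p : ℝ}
    (hp : 1 < p) (hp3 : p ≤ 3) :
    ∫ ω, |∑ j, a j * ((N j ω : ℝ) - r j)| ^ p ∂P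
      = ∑ i, r i * ∫ ω, a i * (oddPow p (∑ j, a j * ((N j ω : ℝ) - r j) + a i)
          - oddPow p (∑ j, a j * ((N j ω : ℝ) - r j))) ∂P := by
  set S : Ω → ℝ := fun ω => ∑ j, a j * ((N j ω : ℝ) - r j) with hS
  have hS3 : MemLp S 3 P := memLp_poissonSum hN hlaw a 3
  have hN3 : ∀ i, MemLp (fun ω => (N i ω : ℝ)) 3 P := fun i =>
    memLp_natCast_of_poisson (hN i) (hlaw i) 3
  have hφ : Integrable (fun ω => oddPow p (S ω)) P := by
    simpa using integrable_mul_oddPow hp hp3 (memLp_const (1 : ℝ)) hS3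
  have hφ' : ∀ i, Integrable (fun ω => oddPow p (S ω + a i)) P := fun i => by
    simpa using integrable_mul_oddPow hp hp3 (memLp_const (1 : ℝ)) (hS3.add (memLp_const (a i)))
  have hNφ : ∀ i, Integrable (fun ω => (N i ω : ℝ) * oddPow p (S ω)) P := fun i =>
    integrable_mul_oddPow hp hp3 (hN3 i) hS3
  have h1 : ∀ ω, |S ω| ^ p
      = ∑ i, a i * ((N i ω : ℝ) * oddPow p (S ω) - r i * oddPow p (S ω)) := fun ω => by
    rw [← mul_oddPow hp]
    conv_lhs => rw [hS]
    simp only [Finset.sum_mul]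
    exact Finset.sum_congr rfl fun i _ => by ring
  change ∫ ω, |S ω| ^ p ∂P = ∑ i, r i * ∫ ω, a i * (oddPow p (S ω + a i) - oddPow p (S ω)) ∂P
  simp_rw [h1]
  have hsub : ∀ i, Integrable (fun ω => a i * ((N i ω : ℝ) * oddPow p (S ω)
      - r i * oddPow p (S ω))) P := fun i => ((hNφ i).sub (hφ.const_mul _)).const_mul _
  rw [integral_finsetSum _ fun i _ => hsub i]
  refine Finset.sum_congr rfl fun i _ => ?_
  rw [integral_const_mul, integral_const_mul, integral_sub (hNφ i) (hφ.const_mul _),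
    integral_sub (hφ' i) hφ, integral_const_mul,
    integral_natCast_mul_oddPow_poissonSum hN hlaw hind a p i]
  ring

lemma integral_abs_rpow_poissonSum_le (hN : ∀ i, Measurable (N i))
    (hlaw : ∀ i, P.map (N i) = poissonMeasure (r i)) (hind : iIndepFun N P) (a : ι → ℝ) {p : ℝ}
    (hp : 1 < p) (hp2 : p ≤ 2) :
    ∫ ω, |∑ j, a j * ((N j ω : ℝ) - r j)| ^ p ∂P ≤ 2 * ∑ i, |a i| ^ p * r i := by
  rw [integral_abs_rpow_poissonSum hN hlaw hind a hp (by linarith), Finset.mul_sum]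
  refine Finset.sum_le_sum fun i _ => ?_
  have : ∫ ω, a i * (oddPow p (∑ j, a j * ((N j ω : ℝ) - r j) + a i)
          - oddPow p (∑ j, a j * ((N j ω : ℝ) - r j))) ∂P ≤ 2 * |a i| ^ p := by
    -- Monotonicity of `oddPow` makes the integrand nonnegative, so only the majorant has to be
    -- integrable.
    refine (integral_mono_of_nonneg (ae_of_all _ fun ω => ?_)
      (integrable_const (2 * |a i| ^ p)) (ae_of_all _ fun ω => ?_)).trans_eq (by simp)
    · have hm := oddPow_mono hp
      rcases le_total 0 (a i) with h | h
      · exact mul_nonneg h (sub_nonneg.2 (hm (by linarith)))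
      · exact mul_nonneg_of_nonpos_of_nonpos h (sub_nonpos.2 (hm (by linarith)))
    · exact mul_oddPow_add_sub_le hp hp2 _ _
  calc _ ≤ (r i : ℝ) * (2 * |a i| ^ p) := by gcongr
    _ = _ := by ring

lemma integral_abs_rpow_poissonSum_le_of_two_le (hN : ∀ i, Measurable (N i))
    (hlaw : ∀ i, P.map (N i) = poissonMeasure (r i)) (hind : iIndepFun N P) (a : ι → ℝ) {p : ℝ}
    (hp : 2 ≤ p) (hp3 : p ≤ 3) :
    ∫ ω, |∑ j, a j * ((N j ω : ℝ) - r j)| ^ p ∂P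
      ≤ 2 * (∑ i, |a i| ^ (2 : ℝ) * r i) * (1 + 2 * ∑ i, |a i| ^ (2 : ℝ) * r i)
        + ∑ i, |a i| ^ p * r i := by
  have hV := integral_abs_rpow_poissonSum_le hN hlaw hind a one_lt_two le_rfl
  set V := ∑ i, |a i| ^ (2 : ℝ) * r i with hVdef
  simp only [Real.rpow_two, sq_abs] at hV
  rw [integral_abs_rpow_poissonSum hN hlaw hind a (by linarith) hp3]
  have hS2 : Integrable (fun ω => (∑ j, a j * ((N j ω : ℝ) - r j)) ^ 2) P :=
    (memLp_poissonSum hN hlaw a 2).integrable_sq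
  have : ∀ i, ∫ ω, a i * (oddPow p (∑ j, a j * ((N j ω : ℝ) - r j) + a i)
          - oddPow p (∑ j, a j * ((N j ω : ℝ) - r j))) ∂P
        ≤ 2 * a i ^ 2 * (1 + 2 * V) + |a i| ^ p := fun i => by
    have hint1 : Integrable (fun ω => 2 * a i ^ 2 * (1 + (∑ j, a j * ((N j ω : ℝ) - r j)) ^ 2)) P :=
      ((integrable_const 1).add hS2).const_mul _
    have hint : Integrable (fun ω => 2 * a i ^ 2 * (1 + (∑ j, a j * ((N j ω : ℝ) - r j)) ^ 2)
        + |a i| ^ p) P := hint1.add (integrable_const _)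
    refine (integral_mono_of_nonneg (ae_of_all _ fun ω => ?_)
      hint (ae_of_all _ fun ω => ?_)).trans ?_
    · have hm := oddPow_mono (by linarith : 1 < p)
      rcases le_total 0 (a i) with h | h
      · exact mul_nonneg h (sub_nonneg.2 (hm (by linarith)))
      · exact mul_nonneg_of_nonpos_of_nonpos h (sub_nonpos.2 (hm (by linarith)))
    · exact mul_oddPow_add_sub_le_of_two_le hp hp3 _ _
    · rw [integral_add hint1 (integrable_const _),
        integral_const_mul, integral_add (integrable_const 1) hS2]
      simp only [integral_const, probReal_univ, smul_eq_mul, one_mul]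
      gcongr
  calc _ ≤ ∑ i, (r i : ℝ) * (2 * a i ^ 2 * (1 + 2 * V) + |a i| ^ p) :=
        Finset.sum_le_sum fun i _ => mul_le_mul_of_nonneg_left (this i) (r i).2
    _ = _ := by
        have h2 : V = ∑ i, r i * a i ^ 2 := by
          rw [hVdef]
          exact Finset.sum_congr rfl fun i _ => by rw [Real.rpow_two, sq_abs]; ring
        calc _ = ∑ i, (2 * (1 + 2 * V) * (r i * a i ^ 2) + |a i| ^ p * r i) :=
              Finset.sum_congr rfl fun i _ => by ring
          _ = _ := by rw [Finset.sum_add_distrib, ← Finset.mul_sum, ← h2]; ring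

end FiniteSum

end LevyHeat

/-! ### Moment inequalities for Poisson random measures -/

namespace LevyHeat

lemma lintegral_poissonLaw (a : ℝ≥0∞) : ∫⁻ x, x ∂poissonLaw a = a := by
  unfold poissonLaw
  split_ifs with h
  · simp [h]
  · rw [lintegral_map (f := fun x => x) measurable_id (by fun_prop)]
    have := lintegral_natCast_mul_poissonMeasure a.toNNReal fun _ => 1
    simp only [mul_one, lintegral_const, measure_univ, ENNReal.coe_toNNReal h] at this
    simpa using this

/-- Counts take values in `[0, ∞]`; the floor converts them to `ℕ`-valued variables, and as a
measurable map it preserves independence. -/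
lemma map_floor_poissonLaw {a : ℝ≥0∞} (ha : a ≠ ∞) :
    (poissonLaw a).map (fun x => ⌊x.toReal⌋₊) = poissonMeasure a.toNNReal := by
  rw [poissonLaw, if_neg ha, Measure.map_map (by fun_prop) (by fun_prop)]
  convert Measure.map_id
  ext n
  simp

lemma ae_poissonLaw_toReal_eq_floor {a : ℝ≥0∞} (ha : a ≠ ∞) :
    ∀ᵐ x ∂poissonLaw a, x.toReal = (⌊x.toReal⌋₊ : ℝ) := by
  rw [poissonLaw, if_neg ha, ae_map_iff (by fun_prop)
    (measurableSet_eq_fun (by fun_prop) (by fun_prop))]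
  simp

namespace IsPoissonRandomMeasure

variable {Ω E : Type*} [MeasurableSpace Ω] [MeasurableSpace E] {P : Measure Ω}
  {μ : Ω → Measure E} {ν : Measure E}

lemma measurable_measure (hμ : IsPoissonRandomMeasure μ ν P) : Measurable μ :=
  Measure.measurable_of_measurable_coe _ hμ.measurable

lemma bind_eq (hμ : IsPoissonRandomMeasure μ ν P) : P.bind μ = ν := by
  ext A hA
  rw [Measure.bind_apply hA hμ.measurable_measure.aemeasurable,
    ← lintegral_map (f := fun x => x) measurable_id (hμ.measurable A hA), hμ.law A hA]
  exact lintegral_poissonLaw _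

/-- Campbell's formula. -/
lemma lintegral_lintegral (hμ : IsPoissonRandomMeasure μ ν P) {h : E → ℝ≥0∞} (hh : Measurable h) :
    ∫⁻ ω, ∫⁻ x, h x ∂μ ω ∂P = ∫⁻ x, h x ∂ν := by
  conv_rhs => rw [← hμ.bind_eq]
  exact (Measure.lintegral_bind hμ.measurable_measure.aemeasurable hh.aemeasurable).symm

lemma ae_integrable (hμ : IsPoissonRandomMeasure μ ν P) {f : E → ℝ} (hf : Measurable f)
    (hint : Integrable f ν) : ∀ᵐ ω ∂P, Integrable f (μ ω) := by
  have h1 := hμ.lintegral_lintegral hf.enorm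
  have h2 : ∀ᵐ ω ∂P, ∫⁻ x, ‖f x‖ₑ ∂μ ω < ∞ := by
    refine ae_lt_top ((Measure.measurable_lintegral hf.enorm).comp hμ.measurable_measure) ?_
    rw [h1]
    exact hint.2.ne
  filter_upwards [h2] with ω hω
  exact ⟨hf.aestronglyMeasurable, hω⟩

lemma aestronglyMeasurable_integral (hμ : IsPoissonRandomMeasure μ ν P) {f : E → ℝ}
    (hf : Measurable f) (hint : Integrable f ν) :
    AEStronglyMeasurable (fun ω => ∫ x, f x ∂μ ω) P := by
  have hm : ∀ h : E → ℝ≥0∞, Measurable h → Measurable fun ω => (∫⁻ x, h x ∂μ ω).toReal :=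
    fun h hh => ((Measure.measurable_lintegral hh).comp hμ.measurable_measure).ennreal_toReal
  refine ⟨_, ((hm (fun x => ENNReal.ofReal (f x)) (by fun_prop)).sub
    (hm (fun x => ENNReal.ofReal (-f x)) (by fun_prop))).stronglyMeasurable, ?_⟩
  filter_upwards [hμ.ae_integrable hf hint] with ω hω
  exact integral_eq_lintegral_pos_part_sub_lintegral_neg_part hω

/-- The centred integral of a simple function is a weighted sum of independent centred Poisson
variables. -/
lemma exists_poissonSum (hμ : IsPoissonRandomMeasure μ ν P) (g : SimpleFunc E ℝ)
    (hg : Integrable g ν) :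
    ∃ (n : ℕ) (N : Fin n → Ω → ℕ) (r : Fin n → ℝ≥0) (a : Fin n → ℝ),
      (∀ i, Measurable (N i)) ∧ (∀ i, P.map (N i) = poissonMeasure (r i)) ∧ iIndepFun N P ∧
      (∀ᵐ ω ∂P, ∫ x, g x ∂μ ω - ∫ x, g x ∂ν = ∑ i, a i * ((N i ω : ℝ) - r i)) ∧
      ∀ q : ℝ, 0 < q → ∫⁻ x, ‖g x‖ₑ ^ q ∂ν = ENNReal.ofReal (∑ i, |a i| ^ q * r i) := by
  -- The fibre over `0` may have infinite intensity and contributes nothing; integrability makes all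
  -- other fibres finite.
  set s : Finset ℝ := {x ∈ g.range | x ≠ 0} with hs
  let e : Fin s.card ≃ s := s.equivFin.symm
  have hfin : ∀ i, ν (g ⁻¹' {(e i : ℝ)}) ≠ ∞ := fun i => by
    have hi : (e i : ℝ) ≠ 0 := (Finset.mem_filter.1 (e i).2).2
    exact ((SimpleFunc.integrable_iff.1 hg) _ hi).ne
  have hmeas : ∀ i, MeasurableSet (g ⁻¹' {(e i : ℝ)}) := fun i => g.measurableSet_fiber _
  have hfl : Measurable fun x : ℝ≥0∞ => ⌊x.toReal⌋₊ := by fun_prop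
  refine ⟨s.card, fun i ω => ⌊(μ ω (g ⁻¹' {(e i : ℝ)})).toReal⌋₊,
    fun i => (ν (g ⁻¹' {(e i : ℝ)})).toNNReal, fun i => e i, fun i => ?_, fun i => ?_, ?_, ?_, ?_⟩
  · exact hfl.comp (hμ.measurable _ (hmeas i))
  · rw [← map_floor_poissonLaw (hfin i), ← hμ.law _ (hmeas i),
      Measure.map_map hfl (hμ.measurable _ (hmeas i))]
    rfl
  · refine (hμ.indep s.card (fun i => g ⁻¹' {(e i : ℝ)}) hmeas fun i j hij => ?_).comp
      (fun _ x => ⌊x.toReal⌋₊) fun _ => hfl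
    refine Disjoint.preimage _ ?_
    simpa [Subtype.val_inj] using hij
  · have hN : ∀ᵐ ω ∂P, ∀ i, (μ ω (g ⁻¹' {(e i : ℝ)})).toReal
        = (⌊(μ ω (g ⁻¹' {(e i : ℝ)})).toReal⌋₊ : ℝ) := by
      rw [ae_all_iff]
      intro i
      have := ae_poissonLaw_toReal_eq_floor (hfin i)
      rw [← hμ.law _ (hmeas i)] at this
      exact ae_of_ae_map (hμ.measurable _ (hmeas i)).aemeasurable this
    have hsum : ∀ ρ : Measure E, Integrable g ρ →
        ∫ x, g x ∂ρ = ∑ i, (e i : ℝ) * (ρ (g ⁻¹' {(e i : ℝ)})).toReal := fun ρ hρ => by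
      rw [← SimpleFunc.integral_eq_integral _ hρ, SimpleFunc.integral_eq_sum_filter,
        Equiv.sum_comp e fun x : s => (x : ℝ) * (ρ (g ⁻¹' {(x : ℝ)})).toReal,
        Finset.sum_coe_sort s fun x => x * (ρ (g ⁻¹' {x})).toReal]
      exact Finset.sum_congr rfl fun x _ => by rw [smul_eq_mul, mul_comm]; rfl
    filter_upwards [hN, hμ.ae_integrable g.measurable hg] with ω hω hi
    rw [hsum _ hi, hsum _ hg, ← Finset.sum_sub_distrib]
    refine Finset.sum_congr rfl fun i _ => ?_
    rw [← hω i, mul_sub]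
    rfl
  · intro q hq
    have h1 : ∫⁻ x, ‖g x‖ₑ ^ q ∂ν = ∑ x ∈ s, ‖x‖ₑ ^ q * ν (g ⁻¹' {x}) := by
      rw [hs, Finset.sum_filter_of_ne, ← SimpleFunc.map_lintegral (fun x : ℝ => ‖x‖ₑ ^ q),
        ← SimpleFunc.lintegral_eq_lintegral]
      · rfl
      · rintro x - hx rfl
        simp [hq] at hx
    rw [h1, ENNReal.ofReal_sum_of_nonneg fun i _ => by positivity,
      ← Finset.sum_coe_sort s, ← Equiv.sum_comp e]
    refine Finset.sum_congr rfl fun i _ => ?_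
    rw [ENNReal.ofReal_mul (by positivity), ← ENNReal.ofReal_rpow_of_nonneg (abs_nonneg _) hq.le,
      Real.enorm_eq_ofReal_abs, ENNReal.ofReal_coe_nnreal, ENNReal.coe_toNNReal (hfin i)]

/-- Moment bounds for centred Poisson integrals pass from simple functions to integrable functions
by dominated convergence and Fatou's lemma. -/
lemma lintegral_rpow_le_of_forall_simpleFunc (hμ : IsPoissonRandomMeasure μ ν P) {f : E → ℝ}
    (hf : Measurable f) (hint : Integrable f ν) {p : ℝ} {B : ℝ≥0∞}
    (hB : ∀ g : SimpleFunc E ℝ, Integrable g ν → (∀ x, ‖g x‖ₑ ≤ 2 * ‖f x‖ₑ) →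
      ∫⁻ ω, ‖∫ x, g x ∂μ ω - ∫ x, g x ∂ν‖ₑ ^ p ∂P ≤ B) :
    ∫⁻ ω, ‖∫ x, f x ∂μ ω - ∫ x, f x ∂ν‖ₑ ^ p ∂P ≤ B := by
  -- The bound `|g n| ≤ 2 |f|` gives domination under `ν` and under almost every `μ ω` at once; it
  -- is the source of the powers of `2` in the final estimates.
  let g : ℕ → SimpleFunc E ℝ := SimpleFunc.approxOn f hf Set.univ 0 (Set.mem_univ 0)
  have hgf : ∀ n x, ‖g n x‖ ≤ 2 * ‖f x‖ := fun n x => by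
    rw [two_mul]; exact SimpleFunc.norm_approxOn_zero_le hf (Set.mem_univ 0) x n
  have hgf' : ∀ n x, ‖g n x‖ₑ ≤ 2 * ‖f x‖ₑ := fun n x => by
    have := ENNReal.ofReal_le_ofReal (hgf n x)
    rwa [ENNReal.ofReal_mul zero_le_two, ofReal_norm, ofReal_norm, ENNReal.ofReal_ofNat] at this
  have hlim : ∀ x, Tendsto (fun n => g n x) atTop (𝓝 (f x)) := fun x =>
    SimpleFunc.tendsto_approxOn hf (Set.mem_univ 0) (by simp)
  have hconv : ∀ ρ : Measure E, Integrable f ρ →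
      Tendsto (fun n => ∫ x, g n x ∂ρ) atTop (𝓝 (∫ x, f x ∂ρ)) := fun ρ hρ =>
    tendsto_integral_of_dominated_convergence (fun x => 2 * ‖f x‖)
      (fun n => (g n).measurable.aestronglyMeasurable) (hρ.norm.const_mul 2)
      (fun n => ae_of_all _ (hgf n)) (ae_of_all _ hlim)
  have hgint : ∀ n, Integrable (g n) ν := fun n =>
    (hint.norm.const_mul 2).mono' (g n).measurable.aestronglyMeasurable (ae_of_all _ (hgf n))
  have hmeas : ∀ n, AEMeasurable (fun ω => ‖∫ x, g n x ∂μ ω - ∫ x, g n x ∂ν‖ₑ ^ p) P := fun n =>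
    (((hμ.aestronglyMeasurable_integral (g n).measurable (hgint n)).sub
      aestronglyMeasurable_const).enorm).pow_const p
  calc ∫⁻ ω, ‖∫ x, f x ∂μ ω - ∫ x, f x ∂ν‖ₑ ^ p ∂P
      = ∫⁻ ω, liminf (fun n => ‖∫ x, g n x ∂μ ω - ∫ x, g n x ∂ν‖ₑ ^ p) atTop ∂P := by
        refine lintegral_congr_ae ?_
        filter_upwards [hμ.ae_integrable hf hint] with ω hω
        refine (Tendsto.liminf_eq ?_).symm
        exact (ENNReal.continuous_rpow_const.tendsto _).comp
          (((hconv _ hω).sub (hconv _ hint)).enorm)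
    _ ≤ liminf (fun n => ∫⁻ ω, ‖∫ x, g n x ∂μ ω - ∫ x, g n x ∂ν‖ₑ ^ p ∂P) atTop :=
        lintegral_liminf_le' hmeas
    _ ≤ B := by
        refine (liminf_le_liminf (Eventually.of_forall fun n =>
          hB (g n) (hgint n) (hgf' n))).trans_eq ?_
        simp

lemma lintegral_rpow_le_rpow_mul {g f : E → ℝ} (h : ∀ x, ‖g x‖ₑ ≤ 2 * ‖f x‖ₑ)
    (hf : Measurable f) {q : ℝ} (hq : 0 ≤ q) :
    ∫⁻ x, ‖g x‖ₑ ^ q ∂ν ≤ 2 ^ q * ∫⁻ x, ‖f x‖ₑ ^ q ∂ν := by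
  rw [← lintegral_const_mul _ (by fun_prop)]
  refine lintegral_mono fun x => ?_
  rw [← ENNReal.mul_rpow_of_nonneg _ _ hq]
  exact ENNReal.rpow_le_rpow (h x) hq

variable [IsProbabilityMeasure P]

lemma lintegral_enorm_rpow_eq {n : ℕ} {N : Fin n → Ω → ℕ} {r : Fin n → ℝ≥0}
    (hN : ∀ i, Measurable (N i)) (hlaw : ∀ i, P.map (N i) = poissonMeasure (r i)) (a : Fin n → ℝ)
    {p : ℝ} (hp : 0 < p) (hp3 : p ≤ 3) {X : Ω → ℝ}
    (hX : ∀ᵐ ω ∂P, X ω = ∑ i, a i * ((N i ω : ℝ) - r i)) :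
    ∫⁻ ω, ‖X ω‖ₑ ^ p ∂P = ENNReal.ofReal (∫ ω, |∑ i, a i * ((N i ω : ℝ) - r i)| ^ p ∂P) := by
  have hp' : ENNReal.ofReal p ≤ 3 := by simpa using ENNReal.ofReal_le_ofReal hp3
  have hint : Integrable (fun ω => |∑ i, a i * ((N i ω : ℝ) - r i)| ^ p) P := by
    have := ((memLp_poissonSum hN hlaw a 3).mono_exponent
      (p := ENNReal.ofReal p) (by exact_mod_cast hp')).integrable_norm_rpow (by simpa using hp)
      (by simp)
    simpa [ENNReal.toReal_ofReal hp.le] using this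
  rw [ofReal_integral_eq_lintegral_ofReal hint (ae_of_all _ fun ω => by positivity)]
  refine lintegral_congr_ae ?_
  filter_upwards [hX] with ω hω
  rw [hω, Real.enorm_eq_ofReal_abs, ENNReal.ofReal_rpow_of_nonneg (abs_nonneg _) hp.le]

lemma lintegral_rpow_simpleFunc_le (hμ : IsPoissonRandomMeasure μ ν P) (g : SimpleFunc E ℝ)
    (hg : Integrable g ν) {p : ℝ} (hp : 1 < p) (hp2 : p ≤ 2) :
    ∫⁻ ω, ‖∫ x, g x ∂μ ω - ∫ x, g x ∂ν‖ₑ ^ p ∂P ≤ 2 * ∫⁻ x, ‖g x‖ₑ ^ p ∂ν := by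
  obtain ⟨n, N, r, a, hN, hlaw, hind, hS, hq⟩ := hμ.exists_poissonSum g hg
  rw [lintegral_enorm_rpow_eq hN hlaw a (by linarith) (by linarith) hS, hq p (by linarith)]
  refine (ENNReal.ofReal_le_ofReal
    (integral_abs_rpow_poissonSum_le hN hlaw hind a hp hp2)).trans_eq ?_
  rw [ENNReal.ofReal_mul (by norm_num)]
  simp

lemma lintegral_rpow_simpleFunc_le_of_two_le (hμ : IsPoissonRandomMeasure μ ν P)
    (g : SimpleFunc E ℝ) (hg : Integrable g ν) {p : ℝ} (hp : 2 ≤ p) (hp3 : p ≤ 3) :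
    ∫⁻ ω, ‖∫ x, g x ∂μ ω - ∫ x, g x ∂ν‖ₑ ^ p ∂P
      ≤ 2 * (∫⁻ x, ‖g x‖ₑ ^ (2 : ℝ) ∂ν) * (1 + 2 * ∫⁻ x, ‖g x‖ₑ ^ (2 : ℝ) ∂ν)
        + ∫⁻ x, ‖g x‖ₑ ^ p ∂ν := by
  obtain ⟨n, N, r, a, hN, hlaw, hind, hS, hq⟩ := hμ.exists_poissonSum g hg
  rw [lintegral_enorm_rpow_eq hN hlaw a (by linarith) hp3 hS, hq p (by linarith), hq 2 two_pos]
  refine (ENNReal.ofReal_le_ofReal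
    (integral_abs_rpow_poissonSum_le_of_two_le hN hlaw hind a hp hp3)).trans_eq ?_
  have h0 : 0 ≤ ∑ i, |a i| ^ (2 : ℝ) * r i := Finset.sum_nonneg fun i _ => by positivity
  rw [ENNReal.ofReal_add (by positivity) (Finset.sum_nonneg fun i _ => by positivity),
    ENNReal.ofReal_mul (by positivity), ENNReal.ofReal_mul (by positivity),
    ENNReal.ofReal_add (by positivity) (by positivity), ENNReal.ofReal_mul (by positivity)]
  simp

theorem lintegral_rpow_centred_le (hμ : IsPoissonRandomMeasure μ ν P) {f : E → ℝ}
    (hf : Measurable f) (hint : Integrable f ν) {p : ℝ} (hp : 1 < p) (hp2 : p ≤ 2) :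
    ∫⁻ ω, ‖∫ x, f x ∂μ ω - ∫ x, f x ∂ν‖ₑ ^ p ∂P ≤ 2 * (2 ^ p * ∫⁻ x, ‖f x‖ₑ ^ p ∂ν) :=
  hμ.lintegral_rpow_le_of_forall_simpleFunc hf hint fun g hg hgf =>
    (hμ.lintegral_rpow_simpleFunc_le g hg hp hp2).trans <| by
      gcongr
      exact lintegral_rpow_le_rpow_mul hgf hf (by linarith)

theorem lintegral_rpow_centred_le_of_two_le (hμ : IsPoissonRandomMeasure μ ν P) {f : E → ℝ}
    (hf : Measurable f) (hint : Integrable f ν) {p : ℝ} (hp : 2 ≤ p) (hp3 : p ≤ 3) :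
    ∫⁻ ω, ‖∫ x, f x ∂μ ω - ∫ x, f x ∂ν‖ₑ ^ p ∂P
      ≤ 2 * (2 ^ (2 : ℝ) * ∫⁻ x, ‖f x‖ₑ ^ (2 : ℝ) ∂ν)
          * (1 + 2 * (2 ^ (2 : ℝ) * ∫⁻ x, ‖f x‖ₑ ^ (2 : ℝ) ∂ν))
        + 2 ^ p * ∫⁻ x, ‖f x‖ₑ ^ p ∂ν :=
  hμ.lintegral_rpow_le_of_forall_simpleFunc hf hint fun g hg hgf =>
    (hμ.lintegral_rpow_simpleFunc_le_of_two_le g hg hp hp3).trans <| by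
      gcongr
      · exact lintegral_rpow_le_rpow_mul hgf hf zero_le_two
      · exact lintegral_rpow_le_rpow_mul hgf hf zero_le_two
      · exact lintegral_rpow_le_rpow_mul hgf hf (by linarith)

end IsPoissonRandomMeasure

end LevyHeat

/-! ### Power integrals of the heat kernel -/

namespace LevyHeat

variable {d : ℕ}

lemma heatKernel_nonneg (t : ℝ) (x : Space d) : 0 ≤ heatKernel d t x := by
  unfold heatKernel
  split_ifs <;> positivity

lemma measurable_mildKernel (t : ℝ) :
    Measurable fun x : ℝ × Space d => mildKernel t (0 : Space d) x.1 x.2 := by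
  have h : Measurable fun x : ℝ × Space d => heatKernel d (t - x.1) (0 - x.2) := by
    unfold heatKernel
    exact Measurable.ite (measurableSet_lt measurable_const (by fun_prop)) (by fun_prop)
      measurable_const
  have : (fun x : ℝ × Space d => mildKernel t (0 : Space d) x.1 x.2)
      = (Prod.fst ⁻¹' Set.Ioc 0 t).indicator fun x => heatKernel d (t - x.1) (0 - x.2) := by
    ext x
    simp [mildKernel, Set.indicator]
  rw [this]
  exact h.indicator (measurable_fst measurableSet_Ioc)

lemma mildKernel_nonneg (t s : ℝ) (x y : Space d) : 0 ≤ mildKernel t x s y :=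
  Set.indicator_nonneg (fun _ _ => heatKernel_nonneg _ _) _

/-- A power of the kernel is again a Gaussian: its prefactor `(4πu)^(-dq/2)` meets the Gaussian
integral `(4πu/q)^(d/2)`. -/
lemma lintegral_heatKernel_rpow {u q : ℝ} (hu : 0 < u) (hq : 0 < q) :
    ∫⁻ y : Space d, ‖heatKernel d u (0 - y)‖ₑ ^ q
      = ENNReal.ofReal (q ^ (-(d / 2 : ℝ)) * (4 * Real.pi * u) ^ (-(d / 2 * (q - 1) : ℝ))) := by
  have hb : 0 < q / (4 * u) := by positivity
  have hpi : 0 < 4 * Real.pi * u := by positivity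
  have hG := GaussianFourier.integral_rexp_neg_mul_sq_norm (V := Space d) hb
  rw [finrank_euclideanSpace, Fintype.card_fin] at hG
  have hGi : Integrable fun v : Space d => Real.exp (-(q / (4 * u)) * ‖v‖ ^ 2) :=
    -- A nonzero Bochner integral forces integrability.
    .of_integral_ne_zero (by rw [hG]; positivity)
  have hpt : ∀ y : Space d, ‖heatKernel d u (0 - y)‖ₑ ^ q = ENNReal.ofReal
      ((4 * Real.pi * u) ^ (-(d / 2 * q : ℝ)) * Real.exp (-(q / (4 * u)) * ‖y‖ ^ 2)) := by
    intro y
    rw [Real.enorm_eq_ofReal (heatKernel_nonneg _ _),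
      ENNReal.ofReal_rpow_of_nonneg (heatKernel_nonneg _ _) hq.le, heatKernel, if_pos hu, zero_sub,
      norm_neg, Real.mul_rpow (by positivity) (by positivity), ← Real.exp_mul, one_div,
      ← Real.rpow_neg hpi.le, ← Real.rpow_mul hpi.le]
    congr 3
    · ring
    · field_simp
  simp_rw [hpt]
  rw [← ofReal_integral_eq_lintegral_ofReal (hGi.const_mul _)
    (ae_of_all _ fun y => by positivity), integral_const_mul, hG]
  congr 1
  rw [show Real.pi / (q / (4 * u)) = q⁻¹ * (4 * Real.pi * u) by field_simp,
    Real.mul_rpow (by positivity) hpi.le, Real.inv_rpow hq.le, ← Real.rpow_neg hq.le,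
    mul_left_comm, ← Real.rpow_add hpi]
  congr 2
  ring

/-- The constant in `∫_0^t ∫ g(t - s, y)^q dy ds = c t^(1 - d (q - 1) / 2)`. -/
noncomputable def heatConst (d : ℕ) (q : ℝ) : ℝ :=
  q ^ (-(d / 2 : ℝ)) * (4 * Real.pi) ^ (-(d / 2 * (q - 1) : ℝ)) / (1 - d / 2 * (q - 1))

/-- Integrating out space leaves `(t - s)^α` with `α = -(d/2)(q - 1)`; the hypothesis `hqd` says `α
> -1`, which is integrability at `s = t`. -/
lemma lintegral_mildKernel_rpow {t q : ℝ} (ht : 0 < t) (hq : 0 < q) (hqd : d / 2 * (q - 1) < 1) :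
    ∫⁻ x, ‖mildKernel t (0 : Space d) x.1 x.2‖ₑ ^ q
        ∂(((volume : Measure ℝ).restrict (Set.Ioi 0)).prod (volume : Measure (Space d)))
      = ENNReal.ofReal (heatConst d q * t ^ (1 - d / 2 * (q - 1) : ℝ)) := by
  set α : ℝ := -(d / 2 * (q - 1)) with hα
  set c : ℝ := q ^ (-(d / 2 : ℝ)) * (4 * Real.pi) ^ α with hc
  have hc0 : 0 ≤ c := by positivity
  have hα1 : -1 < α := by linarith
  rw [lintegral_prod _ (by have := measurable_mildKernel (d := d) t; fun_prop)]
  -- The kernel vanishes at `s = t`, whereas `0 ^ α` is `1` when `α = 0`; hence the open interval.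
  have hinner : ∀ s : ℝ, ∫⁻ y : Space d, ‖mildKernel t (0 : Space d) s y‖ₑ ^ q
      = (Set.Ioo 0 t).indicator (fun s => ENNReal.ofReal (c * (t - s) ^ α)) s := by
    intro s
    by_cases hs : s ∈ Set.Ioo 0 t
    · have hts : 0 < t - s := by linarith [hs.2]
      have hs' : s ∈ Set.Ioc 0 t := ⟨hs.1, hs.2.le⟩
      simp only [mildKernel, Set.indicator_of_mem hs, Set.indicator_of_mem hs']
      rw [lintegral_heatKernel_rpow hts hq, Real.mul_rpow (by positivity) hts.le, ← mul_assoc]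
    · have h0 : ∀ y : Space d, mildKernel t (0 : Space d) s y = 0 := fun y => by
        unfold mildKernel
        refine Set.indicator_apply_eq_zero.2 fun hs' => ?_
        have : ¬ 0 < t - s := fun h => hs ⟨hs'.1, by linarith⟩
        rw [heatKernel, if_neg this]
      simp [h0, Set.indicator_of_notMem hs, hq]
  simp_rw [hinner]
  rw [lintegral_indicator measurableSet_Ioo, Measure.restrict_restrict measurableSet_Ioo,
    Set.inter_eq_left.2 fun s hs => hs.1, restrict_Ioo_eq_restrict_Ioc]
  have hii : IntervalIntegrable (fun s => c * (t - s) ^ α) volume 0 t := by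
    have := (intervalIntegral.intervalIntegrable_rpow' (a := t) (b := 0) hα1).comp_sub_left t
    simpa using this.const_mul c
  rw [← ofReal_integral_eq_lintegral_ofReal
    ((intervalIntegrable_iff_integrableOn_Ioc_of_le ht.le).1 hii)
    ((ae_restrict_iff' measurableSet_Ioc).2 (ae_of_all _ fun s hs =>
      mul_nonneg hc0 (Real.rpow_nonneg (by linarith [hs.2]) _))),
    ← intervalIntegral.integral_of_le ht.le, intervalIntegral.integral_const_mul,
    intervalIntegral.integral_comp_sub_left (fun s => s ^ α) t, sub_self, sub_zero,
    integral_rpow (Or.inl hα1), Real.zero_rpow (by linarith)]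
  congr 1
  rw [heatConst, ← hα, ← hc, show 1 - (d / 2 * (q - 1) : ℝ) = α + 1 by rw [hα]; ring]
  ring

lemma lintegral_mildKernel {t : ℝ} (ht : 0 < t) :
    ∫⁻ x, ‖mildKernel t (0 : Space d) x.1 x.2‖ₑ
        ∂(((volume : Measure ℝ).restrict (Set.Ioi 0)).prod (volume : Measure (Space d)))
      = ENNReal.ofReal t := by
  simpa [heatConst] using lintegral_mildKernel_rpow (d := d) ht one_pos (by simp)

lemma integrable_mildKernel {t : ℝ} (ht : 0 < t) :
    Integrable (fun x : ℝ × Space d => mildKernel t (0 : Space d) x.1 x.2)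
      (((volume : Measure ℝ).restrict (Set.Ioi 0)).prod volume) := by
  refine ⟨(measurable_mildKernel t).aestronglyMeasurable, ?_⟩
  rw [HasFiniteIntegral, lintegral_mildKernel ht]
  simp

lemma integral_mildKernel {t : ℝ} (ht : 0 < t) :
    ∫ x : ℝ × Space d, mildKernel t (0 : Space d) x.1 x.2
      ∂(((volume : Measure ℝ).restrict (Set.Ioi 0)).prod volume) = t := by
  rw [integral_eq_lintegral_of_nonneg_ae (ae_of_all _ fun x => mildKernel_nonneg _ _ _ _)
    (measurable_mildKernel t).aestronglyMeasurable]
  have := lintegral_mildKernel (d := d) ht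
  simp_rw [Real.enorm_eq_ofReal (mildKernel_nonneg _ _ _ _)] at this
  rw [this, ENNReal.toReal_ofReal ht.le]

/-! ### Integrals against the intensity measure -/

/-- By Markov's inequality the sets `|z| ≥ 1/(n+1)` have finite mass, and the remaining point `0` is
null. Product integration against `lam` relies on this. -/
lemma sigmaFinite_of_integrable_abs {lam : Measure ℝ} (h0 : lam {0} = 0)
    (hone : Integrable (fun z : ℝ => |z|) lam) : SigmaFinite lam := by
  refine ⟨⟨⟨fun n : ℕ => {0} ∪ {z : ℝ | 1 / ((n : ℝ) + 1) ≤ |z|}, fun _ => trivial, fun n => ?_,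
    ?_⟩⟩⟩
  · refine (measure_union_le _ _).trans_lt ?_
    rw [h0, zero_add]
    simpa using hone.measure_norm_ge_lt_top (by positivity : 0 < 1 / ((n : ℝ) + 1))
  · refine Set.eq_univ_of_forall fun z => Set.mem_iUnion.2 ?_
    rcases eq_or_ne z 0 with rfl | hz
    · exact ⟨0, by simp⟩
    · obtain ⟨n, hn⟩ := exists_nat_one_div_lt (abs_pos.2 hz)
      exact ⟨n, Or.inr hn.le⟩

variable {lam : Measure ℝ}

lemma measurable_mildKernel_mul (t : ℝ) :
    Measurable fun x : ℝ × Space d × ℝ => mildKernel t (0 : Space d) x.1 x.2.1 * x.2.2 :=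
  ((measurable_mildKernel t).comp (f := fun x : ℝ × Space d × ℝ => (x.1, x.2.1))
    (by fun_prop)).mul (by fun_prop)

lemma lintegral_intensity_rpow [SigmaFinite lam] {t q : ℝ} (ht : 0 < t) (hq : 0 < q)
    (hqd : d / 2 * (q - 1) < 1) :
    ∫⁻ x, ‖mildKernel t (0 : Space d) x.1 x.2.1 * x.2.2‖ₑ ^ q ∂intensity d lam
      = ENNReal.ofReal (heatConst d q * t ^ (1 - d / 2 * (q - 1) : ℝ)) * ∫⁻ z, ‖z‖ₑ ^ q ∂lam := by
  have hm := measurable_mildKernel_mul (d := d) t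
  rw [intensity, ← (measurePreserving_prodAssoc _ _ _).lintegral_comp (by fun_prop),
    ← lintegral_mildKernel_rpow ht hq hqd,
    ← lintegral_prod_mul (by have := measurable_mildKernel (d := d) t; fun_prop) (by fun_prop)]
  refine lintegral_congr fun x => ?_
  rw [← ENNReal.mul_rpow_of_nonneg _ _ hq.le, ← enorm_mul]
  rfl

lemma integrable_intensity [SigmaFinite lam] (hone : Integrable (fun z : ℝ => |z|) lam) {t : ℝ}
    (ht : 0 < t) :
    Integrable (fun x : ℝ × Space d × ℝ => mildKernel t (0 : Space d) x.1 x.2.1 * x.2.2)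
      (intensity d lam) := by
  refine ⟨(measurable_mildKernel_mul t).aestronglyMeasurable, ?_⟩
  have h := lintegral_intensity_rpow (d := d) (lam := lam) ht one_pos (by simp)
  simp only [ENNReal.rpow_one] at h
  rw [HasFiniteIntegral, h]
  exact ENNReal.mul_lt_top (by simp) (by simpa [HasFiniteIntegral] using hone.2)

lemma integral_intensity [SigmaFinite lam] {t : ℝ} (ht : 0 < t) :
    ∫ x, mildKernel t (0 : Space d) x.1 x.2.1 * x.2.2 ∂intensity d lam = t * ∫ z, z ∂lam := by
  rw [intensity, ← (measurePreserving_prodAssoc _ _ _).integral_comp']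
  conv_rhs => rw [← integral_mildKernel (d := d) ht]
  exact integral_prod_mul (fun x : ℝ × Space d => mildKernel t (0 : Space d) x.1 x.2)
    (fun z : ℝ => z)

/-- Interpolation: `|z|^q ≤ |z|` for small jumps and `|z|^q ≤ |z|^(1+ε)` for large ones. -/
lemma lintegral_rpow_lt_top {ε q : ℝ} (hone : Integrable (fun z : ℝ => |z|) lam)
    (hmom : Integrable (fun z : ℝ => |z| ^ (1 + ε)) lam) (hq : 1 ≤ q) (hqε : q ≤ 1 + ε) :
    ∫⁻ z, ‖z‖ₑ ^ q ∂lam < ∞ := by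
  refine lt_of_le_of_lt (lintegral_mono fun z => ?_) (hone.add hmom).2
  rw [Real.enorm_eq_ofReal_abs, ENNReal.ofReal_rpow_of_nonneg (abs_nonneg z) (by linarith),
    Real.enorm_eq_ofReal (by simp only [Pi.add_apply]; positivity)]
  refine ENNReal.ofReal_le_ofReal ?_
  simp only [Pi.add_apply]
  have h1 : 0 ≤ |z| ^ (1 + ε) := by positivity
  rcases le_total |z| 1 with h | h
  · rcases (abs_nonneg z).eq_or_lt with h0 | h0
    · rw [← h0, Real.zero_rpow (by linarith)]
      rw [← h0] at h1
      linarith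
    · have := Real.rpow_le_rpow_of_exponent_ge h0 h hq
      rw [Real.rpow_one] at this
      linarith
  · have := Real.rpow_le_rpow_of_exponent_le h hqε
    linarith [abs_nonneg z]

/-- The `q`-th moment of the kernel of `Y(t, 0) / t`. -/
noncomputable def scaledMoment (d : ℕ) (lam : Measure ℝ) (q t : ℝ) : ℝ≥0∞ :=
  ∫⁻ x, ‖t⁻¹ * (mildKernel t (0 : Space d) x.1 x.2.1 * x.2.2)‖ₑ ^ q ∂intensity d lam

/-- The normalisation contributes `t^(-q)`, so the exponent `1 - (d/2)(q - 1)` becomes `-(d/2 + 1)(q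
- 1)`, negative exactly when `q > 1`. -/
lemma scaledMoment_eq [SigmaFinite lam] {t q : ℝ} (ht : 0 < t) (hq : 0 < q)
    (hqd : d / 2 * (q - 1) < 1) :
    scaledMoment d lam q t
      = ENNReal.ofReal (heatConst d q * t ^ (-((d / 2 + 1) * (q - 1)) : ℝ))
        * ∫⁻ z, ‖z‖ₑ ^ q ∂lam := by
  have hm := measurable_mildKernel_mul (d := d) t
  unfold scaledMoment
  simp_rw [enorm_mul t⁻¹, ENNReal.mul_rpow_of_nonneg _ _ hq.le]
  rw [lintegral_const_mul _ (by fun_prop), lintegral_intensity_rpow ht hq hqd, ← mul_assoc,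
    Real.enorm_eq_ofReal (by positivity), ENNReal.ofReal_rpow_of_nonneg (by positivity) hq.le,
    ← ENNReal.ofReal_mul (by positivity), mul_left_comm, Real.inv_rpow ht.le, ← Real.rpow_neg ht.le,
    ← Real.rpow_add ht]
  congr 5
  ring

lemma scaledMoment_lt_top [SigmaFinite lam] {t q : ℝ} (ht : 0 < t) (hq : 0 < q)
    (hqd : d / 2 * (q - 1) < 1) (hmom : ∫⁻ z, ‖z‖ₑ ^ q ∂lam < ∞) : scaledMoment d lam q t < ∞ := by
  rw [scaledMoment_eq ht hq hqd]
  exact ENNReal.mul_lt_top (by simp) hmom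

lemma tendsto_scaledMoment [SigmaFinite lam] {q : ℝ} (hq : 1 < q)
    (hqd : d / 2 * (q - 1) < 1) (hmom : ∫⁻ z, ‖z‖ₑ ^ q ∂lam < ∞) :
    Tendsto (scaledMoment d lam q) atTop (𝓝 0) := by
  have h1 : Tendsto (fun t : ℝ => heatConst d q * t ^ (-((d / 2 + 1) * (q - 1)) : ℝ)) atTop
      (𝓝 (heatConst d q * 0)) :=
    (tendsto_rpow_neg_atTop (mul_pos (by positivity) (by linarith))).const_mul _
  have h2 := ENNReal.Tendsto.mul_const (ENNReal.tendsto_ofReal h1) (Or.inr hmom.ne)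
  rw [mul_zero, ENNReal.ofReal_zero, zero_mul] at h2
  refine h2.congr' ?_
  filter_upwards [eventually_gt_atTop 0] with t ht
  exact (scaledMoment_eq ht (by linarith) hqd).symm

end LevyHeat

/-! ### Deviation of the normalised solution from its mean -/

namespace LevyHeat

variable {Ω : Type*} {d : ℕ} {lam : Measure ℝ}
  {μ : Ω → Measure (ℝ × Space d × ℝ)}

/-- The deviation `Y(t, 0) / t - m` is a centred Poisson integral. -/
lemma mildSolution_div_sub [SigmaFinite lam] (m : ℝ) {t : ℝ} (ht : 0 < t) (ω : Ω) :
    mildSolution m lam μ t 0 ω / t - m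
      = ∫ x, t⁻¹ * (mildKernel t (0 : Space d) x.1 x.2.1 * x.2.2) ∂μ ω
        - ∫ x, t⁻¹ * (mildKernel t (0 : Space d) x.1 x.2.1 * x.2.2) ∂intensity d lam := by
  -- The kernel has total mass `t`, so the drift divided by `t` is `m - ∫ z dλ`: `m` cancels, and
  -- what is left is the compensator.
  rw [integral_const_mul, integral_const_mul, integral_intensity ht, mildSolution, noiseIntegral,
    integral_mildKernel ht, drift]
  field_simp
  ring

variable [MeasurableSpace Ω] {P : Measure Ω}

lemma aestronglyMeasurable_mildSolution_div [SigmaFinite lam]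
    (hone : Integrable (fun z : ℝ => |z|) lam)
    (hμ : IsPoissonRandomMeasure μ (intensity d lam) P) (m : ℝ) {t : ℝ} (ht : 0 < t) :
    AEStronglyMeasurable (fun ω => mildSolution m lam μ t 0 ω / t) P := by
  simp_rw [div_eq_mul_inv]
  exact (aestronglyMeasurable_const.add (hμ.aestronglyMeasurable_integral
    (measurable_mildKernel_mul t) (integrable_intensity hone ht))).mul_const t⁻¹

variable [IsProbabilityMeasure P]

/-- The bound on the `p`-th moment of `Y(t, 0) / t - m` in terms of the moments of its kernel. -/
noncomputable def momentBound (d : ℕ) (lam : Measure ℝ) (p t : ℝ) : ℝ≥0∞ :=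
  if p ≤ 2 then 2 * (2 ^ p * scaledMoment d lam p t)
  else 2 * (2 ^ (2 : ℝ) * scaledMoment d lam 2 t)
      * (1 + 2 * (2 ^ (2 : ℝ) * scaledMoment d lam 2 t)) + 2 ^ p * scaledMoment d lam p t

lemma lintegral_mildSolution_le [SigmaFinite lam] (hone : Integrable (fun z : ℝ => |z|) lam)
    (hμ : IsPoissonRandomMeasure μ (intensity d lam) P) (m : ℝ) {p t : ℝ} (hp : 1 < p)
    (hp3 : p ≤ 3) (ht : 0 < t) :
    ∫⁻ ω, ‖mildSolution m lam μ t 0 ω / t - m‖ₑ ^ p ∂P ≤ momentBound d lam p t := by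
  have hm := (measurable_mildKernel_mul (d := d) t).const_mul t⁻¹
  have hi := (integrable_intensity (d := d) hone ht).const_mul t⁻¹
  simp_rw [mildSolution_div_sub m ht]
  unfold momentBound
  split_ifs with hp2
  · exact hμ.lintegral_rpow_centred_le hm hi hp hp2
  · exact hμ.lintegral_rpow_centred_le_of_two_le hm hi (not_le.1 hp2).le hp3

lemma momentBound_lt_top [SigmaFinite lam] {p t : ℝ} (ht : 0 < t) (hp : 1 < p)
    (hpd : d / 2 * (p - 1) < 1) (hmom : ∀ q, 1 ≤ q → q ≤ p → ∫⁻ z, ‖z‖ₑ ^ q ∂lam < ∞) :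
    momentBound d lam p t < ∞ := by
  have h1 : scaledMoment d lam p t < ∞ :=
    scaledMoment_lt_top ht (by linarith) hpd (hmom p hp.le le_rfl)
  have h2p : ∀ q : ℝ, 0 ≤ q → (2 : ℝ≥0∞) ^ q < ∞ := fun q hq =>
    ENNReal.rpow_lt_top_of_nonneg hq (by simp)
  have h3 := ENNReal.mul_lt_top (h2p p (by linarith)) h1
  unfold momentBound
  split_ifs with hp2
  · exact ENNReal.mul_lt_top (by simp) h3
  -- The time-integrability condition is monotone in the exponent, so it passes from `p > 2` down to
  -- `2`.
  · have hd2 : (d : ℝ) / 2 * (2 - 1) < 1 :=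
      (mul_le_mul_of_nonneg_left (by linarith) (by positivity)).trans_lt hpd
    have h2 : scaledMoment d lam 2 t < ∞ :=
      scaledMoment_lt_top ht two_pos hd2 (hmom 2 one_le_two (not_le.1 hp2).le)
    have h4 := ENNReal.mul_lt_top (a := 2) (by simp) (ENNReal.mul_lt_top (h2p 2 zero_le_two) h2)
    exact ENNReal.add_lt_top.2
      ⟨ENNReal.mul_lt_top h4 (ENNReal.add_lt_top.2 ⟨by simp, h4⟩), h3⟩

lemma tendsto_momentBound [SigmaFinite lam] {p : ℝ} (hp : 1 < p)
    (hpd : d / 2 * (p - 1) < 1) (hmom : ∀ q, 1 ≤ q → q ≤ p → ∫⁻ z, ‖z‖ₑ ^ q ∂lam < ∞) :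
    Tendsto (momentBound d lam p) atTop (𝓝 0) := by
  have h2p : ∀ q : ℝ, 0 ≤ q → (2 : ℝ≥0∞) ^ q ≠ ∞ := fun q hq =>
    (ENNReal.rpow_lt_top_of_nonneg hq (by simp)).ne
  have hmul : ∀ {c : ℝ≥0∞} {f : ℝ → ℝ≥0∞}, c ≠ ∞ → Tendsto f atTop (𝓝 0) →
      Tendsto (fun t => c * f t) atTop (𝓝 0) := fun {c f} hc hf => by
    simpa using ENNReal.Tendsto.const_mul hf (Or.inr hc)
  have h1 := hmul (h2p p (by linarith)) (tendsto_scaledMoment hp hpd (hmom p hp.le le_rfl))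
  unfold momentBound
  split_ifs with hp2
  · exact hmul (by simp) h1
  · have hd2 : (d : ℝ) / 2 * (2 - 1) < 1 :=
      (mul_le_mul_of_nonneg_left (by linarith) (by positivity)).trans_lt hpd
    have h2 := hmul (c := 2) (by simp) (hmul (h2p 2 zero_le_two)
      (tendsto_scaledMoment one_lt_two hd2 (hmom 2 one_le_two (not_le.1 hp2).le)))
    have h3 := ENNReal.Tendsto.mul h2 (Or.inr (by simp)) (h2.const_add 1) (Or.inr (by simp))
    simpa using h3.add h1

lemma eLpNorm_mildSolution_le [SigmaFinite lam] (hone : Integrable (fun z : ℝ => |z|) lam)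
    (hμ : IsPoissonRandomMeasure μ (intensity d lam) P) (m : ℝ) {p q t : ℝ} (hpq : p ≤ q)
    (hq : 1 < q) (hq3 : q ≤ 3) (ht : 0 < t) :
    eLpNorm (fun ω => mildSolution m lam μ t 0 ω / t - m) (ENNReal.ofReal p) P
      ≤ momentBound d lam q t ^ (1 / q) := by
  have hmeas := aestronglyMeasurable_mildSolution_div hone hμ m ht
  refine (eLpNorm_le_eLpNorm_of_exponent_le (ENNReal.ofReal_le_ofReal hpq)
    (hmeas.sub aestronglyMeasurable_const)).trans ?_
  rw [eLpNorm_eq_lintegral_rpow_enorm_toReal (by simp; linarith) (by simp),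
    ENNReal.toReal_ofReal (by linarith)]
  exact ENNReal.rpow_le_rpow (lintegral_mildSolution_le hone hμ m hq hq3 ht)
    (by positivity)

end LevyHeat

theorem mainTheorem4 {Ω : Type*} [MeasurableSpace Ω] (P : Measure Ω) [IsProbabilityMeasure P]
    (d : ℕ) (hd : 1 ≤ d) (m : ℝ) (lam : Measure ℝ)
    (hlevy : LevyHeat.IsLevyMeasure lam) (hne : lam ≠ 0)
    (hone : Integrable (fun z : ℝ => |z|) lam)
    (μ : Ω → Measure (ℝ × LevyHeat.Space d × ℝ))
    (hμ : LevyHeat.IsPoissonRandomMeasure μ (LevyHeat.intensity d lam) P)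
    (ε : ℝ) (hε : 0 < ε)
    (hmom : Integrable (fun z : ℝ => |z| ^ (1 + ε)) lam)
    (hlog : IntegrableOn (fun z : ℝ => z * Real.log |z|) (Set.Icc (-1) 1) lam)
    (p : ℝ) (hp0 : 0 < p) (hpε : p ≤ 1 + ε) (hpd : p < 1 + 2 / (d : ℝ)) :
    (∀ t : ℝ, 0 < t → ∀ᵐ ω ∂P,
      LevyHeat.NoiseIntegrable (μ ω) (LevyHeat.mildKernel t (0 : LevyHeat.Space d))) ∧
    (∀ t : ℝ, 0 < t →
      MemLp (fun ω => LevyHeat.mildSolution m lam μ t 0 ω / t) (ENNReal.ofReal p) P) ∧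
    Tendsto
      (fun t : ℝ =>
        eLpNorm (fun ω => LevyHeat.mildSolution m lam μ t 0 ω / t - m) (ENNReal.ofReal p) P)
      atTop (𝓝 0) := by
  have hσ : SigmaFinite lam := LevyHeat.sigmaFinite_of_integrable_abs hlevy.zero hone
  have hd0 : (1 : ℝ) ≤ d := by exact_mod_cast hd
  have hinv : 0 < 1 / (d : ℝ) := by positivity
  have hinv1 : 1 / (d : ℝ) ≤ 1 := by rw [div_le_one (by positivity)]; exact hd0
  have htwo : 2 / (d : ℝ) = 2 * (1 / d) := by ring
  -- `p` may be at most `1`, where the moment bounds give nothing. It is raised to an exponent above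
  -- `1`; `1 + 1/d` is a point strictly inside the range allowed by the kernel.
  obtain ⟨q, hpq, hq, hqε, hqd⟩ : ∃ q, p ≤ q ∧ 1 < q ∧ q ≤ 1 + ε ∧ q < 1 + 2 / (d : ℝ) :=
    ⟨max p (min (1 + ε) (1 + 1 / d)), le_max_left _ _,
      lt_max_of_lt_right (lt_min (by linarith) (by linarith)),
      max_le hpε (min_le_left _ _),
      max_lt hpd ((min_le_right _ _).trans_lt (by linarith))⟩
  have hq3 : q ≤ 3 := by linarith
  have hqd' : (d : ℝ) / 2 * (q - 1) < 1 := by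
    calc (d : ℝ) / 2 * (q - 1) < d / 2 * (2 / d) :=
          mul_lt_mul_of_pos_left (by linarith) (by positivity)
      _ = 1 := by field_simp
  have hfin : ∀ q', 1 ≤ q' → q' ≤ q → ∫⁻ z, ‖z‖ₑ ^ q' ∂lam < ∞ := fun q' h1 h2 =>
    LevyHeat.lintegral_rpow_lt_top hone hmom h1 (h2.trans hqε)
  refine ⟨fun t ht => ?_, fun t ht => ?_, ?_⟩
  · filter_upwards [hμ.ae_integrable (LevyHeat.measurable_mildKernel_mul t)
      (LevyHeat.integrable_intensity hone ht)] with ω hω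
    exact ⟨LevyHeat.integrable_mildKernel ht, hω⟩
  · have hmeas := LevyHeat.aestronglyMeasurable_mildSolution_div hone hμ m ht
    have h : MemLp (fun ω => LevyHeat.mildSolution m lam μ t 0 ω / t - m) (ENNReal.ofReal p) P := by
      refine ⟨hmeas.sub aestronglyMeasurable_const,
        (LevyHeat.eLpNorm_mildSolution_le hone hμ m hpq hq hq3 ht).trans_lt ?_⟩
      exact ENNReal.rpow_lt_top_of_nonneg (by positivity)
        (LevyHeat.momentBound_lt_top ht hq hqd' hfin).ne
    exact (h.add (memLp_const m)).ae_eq (ae_of_all _ fun ω => sub_add_cancel _ _)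
  · have hlim : Tendsto (fun t => LevyHeat.momentBound d lam q t ^ (1 / q)) atTop (𝓝 0) := by
      have := (LevyHeat.tendsto_momentBound hq hqd' hfin).ennrpow_const (1 / q)
      rwa [ENNReal.zero_rpow_of_pos (by positivity)] at this
    refine tendsto_of_tendsto_of_tendsto_of_le_of_le' tendsto_const_nhds hlim
      (Eventually.of_forall fun _ => zero_le) ?_
    filter_upwards [eventually_gt_atTop 0] with t ht
    exact LevyHeat.eLpNorm_mildSolution_le hone hμ m hpq hq hq3 ht
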